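/- Let $(\mathbb V,\circ)$ be a finite-dimensional real Euclidean Jordan algebra with identity $e$: $\circ$ is bilinear and commutative, $x^2\circ(x\circ y)=x\circ(x^2\circ y)$ for all $x,y$, and there is an inner product on $\mathbb V$ with $\langle x,y\circ z\rangle=\langle x\circ y,z\rangle$ for all $x,y,z$. Let $\mathcal K=\{x\circ x:x\in\mathbb V\}$ be its cone of squares, and write $u\succeq v$ if $u-v\in\mathcal K$ and $u\succ v$ if $u-v\in\operatorname{int}\mathcal K$. Every $x\in\mathbb V$ has a spectral decomposition $x=\sum_i\lambda_i q_i$, where $\lambda_i\in\mathbb R$ are the eigenvalues of $x$ and $(q_i)$ is a Jordan frame, i.e. a finite family of pairwise orthogonal ($q_i\circ q_j=0$ for $i\neq j$) primitive idempotents with $\sum_i q_i=e$; for a real function $f$ defined at all $\lambda_i$ put $f(x)=\sum_i f(\lambda_i)q_i$, in particular $x^{-1}=\sum_i\lambda_i^{-1}q_i$ and $\ln x=\sum_i\ln(\lambda_i)q_i$. Let $x,y\in\mathbb V$ satisfy $y\succeq x\succ 0$. Then $y\succ 0$; all eigenvalues of $x$ and of $y$ are positive, so that $x^{-1},y^{-1},\ln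 x,\ln y$ are defined; and $$y^{-1}\preceq x^{-1},\qquad \ln y\succeq\ln x .$$ -/

import Mathlib

noncomputable section

/-- Throughout, `V` is a real commutative, not necessarily associative, unital algebra with product
`x * y` and identity `1`; the Jordan identity is Mathlib's `IsCommJordan`. Such an algebra is
Euclidean if it carries an inner product for which the product is associative. -/
def IsEuclideanJordan (V : Type*) [NonAssocCommRing V] [Module ℝ V] : Prop :=
  IsCommJordan V ∧
    ∃ B : LinearMap.BilinForm ℝ V,
      (∀ x y : V, B x y = B y x) ∧
      (∀ x : V, x ≠ 0 → 0 < B x x) ∧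
      ∀ x y z : V, B x (y * z) = B (x * y) z

/-- The cone of squares `K = {x² : x ∈ V}`. -/
def coneOfSquares (V : Type*) [NonAssocCommRing V] : Set V :=
  {z | ∃ x : V, z = x * x}

/-- `x ⪯ y`, i.e. `y - x` lies in the cone of squares. -/
def ConeLE {V : Type*} [NonAssocCommRing V] (x y : V) : Prop :=
  y - x ∈ coneOfSquares V

/-- `x ≺ y`, i.e. `y - x` lies in the interior of the cone of squares. -/
def ConeLT {V : Type*} [NonAssocCommRing V] [TopologicalSpace V] (x y : V) : Prop :=
  y - x ∈ interior (coneOfSquares V)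

/-- A primitive idempotent: nonzero, and not a sum of two nonzero idempotents. -/
structure IsPrimitiveIdempotent {V : Type*} [NonAssocCommRing V] (c : V) : Prop where
  mul_self : c * c = c
  ne_zero : c ≠ 0
  primitive : ∀ a b : V, a * a = a → b * b = b → a + b = c → a = 0 ∨ b = 0

/-- A Jordan frame: a complete system of pairwise orthogonal primitive idempotents. -/
structure IsJordanFrame {V : Type*} [NonAssocCommRing V] {n : ℕ} (q : Fin n → V) : Prop where
  primitive : ∀ i, IsPrimitiveIdempotent (q i)
  orthogonal : ∀ i j, i ≠ j → q i * q j = 0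
  complete : ∑ i, q i = 1

/-- A spectral decomposition `x = ∑ i, λ i • q i` along a Jordan frame; the `λ i` are the
eigenvalues of `x`, with multiplicity. -/
structure SpectralDecomposition {V : Type*} [NonAssocCommRing V] [Module ℝ V] (x : V) where
  n : ℕ
  eigenvalue : Fin n → ℝ
  frame : Fin n → V
  isJordanFrame : IsJordanFrame frame
  eq_sum : x = ∑ i, eigenvalue i • frame i

/-- The value `∑ i, f (λ i) • q i` of `f` along a given spectral decomposition of `x`. -/
def SpectralDecomposition.apply {V : Type*} [NonAssocCommRing V] [Module ℝ V] {x : V}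
    (d : SpectralDecomposition x) (f : ℝ → ℝ) : V :=
  ∑ i, f (d.eigenvalue i) • d.frame i

/-- All eigenvalues of `x` lie in `D`. -/
def EigenvaluesIn {V : Type*} [NonAssocCommRing V] [Module ℝ V] (D : Set ℝ) (x : V) : Prop :=
  ∃ d : SpectralDecomposition x, ∀ i, d.eigenvalue i ∈ D

open Classical in
/-- `f(x) = ∑ i, f (λ i) • q i` for a spectral decomposition `x = ∑ i, λ i • q i`. The value does
not depend on the decomposition, see `jordanFun_eq`. -/
def jordanFun {V : Type*} [NonAssocCommRing V] [Module ℝ V] (f : ℝ → ℝ) (x : V) : V :=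
  if h : Nonempty (SpectralDecomposition x) then h.some.apply f else 0

/-- The inverse `x⁻¹ = ∑ i, (λ i)⁻¹ • q i`. -/
def jordanInv {V : Type*} [NonAssocCommRing V] [Module ℝ V] (x : V) : V :=
  jordanFun (fun t => t⁻¹) x

/-- The logarithm `ln x = ∑ i, ln (λ i) • q i`. -/
def jordanLog {V : Type*} [NonAssocCommRing V] [Module ℝ V] (x : V) : V :=
  jordanFun Real.log x

theorem SpectralDecomposition.iterate_eq {V : Type*} [NonAssocCommRing V] [Module ℝ V]
    [IsScalarTower ℝ V V] [SMulCommClass ℝ V V] {x : V} (d : SpectralDecomposition x) (k : ℕ) :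
    (fun z => x * z)^[k] 1 = ∑ i, (d.eigenvalue i) ^ k • d.frame i := by
  induction k with
  | zero => simp [d.isJordanFrame.complete]
  | succ k ih =>
    rw [Function.iterate_succ_apply', ih]
    have hx : ∀ j, x * d.frame j = d.eigenvalue j • d.frame j := by
      intro j
      have hs : x * d.frame j = (∑ i, d.eigenvalue i • d.frame i) * d.frame j :=
        congrArg (fun z => z * d.frame j) d.eq_sum
      rw [hs, Finset.sum_mul, Finset.sum_eq_single j]
      · rw [smul_mul_assoc, (d.isJordanFrame.primitive j).mul_self]
      · intro i _ hij
        rw [smul_mul_assoc, d.isJordanFrame.orthogonal i j hij, smul_zero]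
      · simp
    rw [Finset.mul_sum]
    refine Finset.sum_congr rfl fun j _ => ?_
    rw [mul_smul_comm, hx, smul_smul, pow_succ]

theorem SpectralDecomposition.apply_polynomial {V : Type*} [NonAssocCommRing V] [Module ℝ V]
    [IsScalarTower ℝ V V] [SMulCommClass ℝ V V] {x : V} (d : SpectralDecomposition x)
    (p : Polynomial ℝ) :
    d.apply (fun t => p.eval t) =
      ∑ k ∈ Finset.range (p.natDegree + 1), p.coeff k • (fun z => x * z)^[k] 1 := by
  simp only [SpectralDecomposition.apply, Polynomial.eval_eq_sum_range, d.iterate_eq,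
    Finset.smul_sum, Finset.sum_smul, smul_smul]
  exact Finset.sum_comm

/-- The value of `f` at `x` is the same along any two spectral decompositions of `x`. -/
theorem SpectralDecomposition.apply_eq {V : Type*} [NonAssocCommRing V] [Module ℝ V]
    [IsScalarTower ℝ V V] [SMulCommClass ℝ V V] {x : V} (d d' : SpectralDecomposition x)
    (f : ℝ → ℝ) : d.apply f = d'.apply f := by
  classical
  let S : Finset ℝ := Finset.univ.image d.eigenvalue ∪ Finset.univ.image d'.eigenvalue
  let p : Polynomial ℝ := Lagrange.interpolate S id f
  have hp : ∀ t ∈ S, p.eval t = f t := fun t ht =>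
    Lagrange.eval_interpolate_at_node f (Function.injective_id.injOn) ht
  have h1 : d.apply f = d.apply (fun t => p.eval t) :=
    Finset.sum_congr rfl fun i _ => by
      beta_reduce
      rw [hp]
      simp [S]
  have h2 : d'.apply f = d'.apply (fun t => p.eval t) :=
    Finset.sum_congr rfl fun i _ => by
      beta_reduce
      rw [hp]
      simp [S]
  rw [h1, h2, d.apply_polynomial, d'.apply_polynomial]

theorem jordanFun_eq {V : Type*} [NonAssocCommRing V] [Module ℝ V]
    [IsScalarTower ℝ V V] [SMulCommClass ℝ V V] {x : V} (d : SpectralDecomposition x)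
    (f : ℝ → ℝ) : jordanFun f x = d.apply f := by
  have h : Nonempty (SpectralDecomposition x) := ⟨d⟩
  rw [jordanFun, dif_pos h]
  exact SpectralDecomposition.apply_eq _ _ f

end

/-! Everything is tested against idempotents `c`: `u` is a square iff `B u c ≥ 0` for all of them,
and `u` has positive eigenvalues iff `B u c > 0` for the nonzero ones (`mem_coneOfSquares_iff`,
`eigenvaluesIn_Ioi_iff`). Positivity of `y` is then immediate.

For the inverse, expand `y - x` along a Jordan frame and add its terms `r • c`, `r ≥ 0`, one at a
time. With `z = x⁻¹`, `m = B z c / B c c` and `P = quadRep`, a Sherman–Morrison formula gives `(x +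
r c)⁻¹ = z - r / (1 + r m) P(z)c`. The subtracted term is in the cone because `P(c)` has range `ℝ
c`, so that `(P(z)c)² = P(z)P(c)z²` is a nonnegative multiple of `P(z)c`.

For the logarithm, `r ↦ B (ln (y + r) - ln (x + r)) c` has derivative `B ((y + r)⁻¹ - (x + r)⁻¹) c ≤
0` and tends to `0` at infinity, hence is nonnegative at `r = 0`. -/

set_option linter.unusedSectionVars false

open Filter Topology

/-- The quadratic representation `P(x) u = 2 x (x u) - x² u`. -/
def quadRep {V : Type*} [NonAssocCommRing V] [Module ℝ V] (x u : V) : V :=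
  (2 : ℝ) • (x * (x * u)) - (x * x) * u

/-! ### Polynomial identities in Jordan algebras -/

section Jordan

variable {V : Type*} [NonAssocCommRing V] [Module ℝ V] [IsCommJordan V]

/-- The linearized Jordan identity. -/
theorem jordan_linearized (a b c w : V) :
    a * ((b * c) * w) + b * ((c * a) * w) + c * ((a * b) * w) =
      (b * c) * (a * w) + (c * a) * (b * w) + (a * b) * (c * w) := by
  have h : (2 : ℕ) • (a * ((b * c) * w) - (b * c) * (a * w) +
      (b * ((c * a) * w) - (c * a) * (b * w)) + (c * ((a * b) * w) - (a * b) * (c * w))) = 0 :=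
    DFunLike.congr_fun (two_nsmul_lie_lmul_lmul_add_add_eq_zero a b c) w
  have h2 : (2 : ℝ) • (a * ((b * c) * w) - (b * c) * (a * w) +
      (b * ((c * a) * w) - (c * a) * (b * w)) + (c * ((a * b) * w) - (a * b) * (c * w))) = 0 := by
    rwa [two_smul, ← two_nsmul]
  have h3 := (smul_eq_zero.mp h2).resolve_left two_ne_zero
  rw [← sub_eq_zero, ← h3]
  abel

/-- The right side of the linearized identity is unchanged when `a` and `w` are exchanged; compare
the two left sides. -/
theorem mul_mul_mul_eq (a b c w : V) :
    (a * (b * c)) * w = a * ((b * c) * w) + b * ((a * c) * w) + c * ((a * b) * w)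
      - b * (a * (c * w)) - c * (a * (b * w)) := by
  have h1 := jordan_linearized a b c w
  have h2 := jordan_linearized w b c a
  simp only [mul_comm] at h1 h2 ⊢
  linear_combination (norm := skip) h2 - h1
  abel

variable [IsScalarTower ℝ V V] [SMulCommClass ℝ V V]

/-- The fundamental formula `P(P(a)b) = P(a)P(b)P(a)` evaluated at `1`. -/
theorem quadRep_mul_self (a b : V) :
    quadRep a b * quadRep a b = quadRep a (quadRep b (a * a)) := by
  have h := fun p q r s : V => jordan_linearized p q r s
  have k : ∀ (m : V) {p q : V}, p = q → m * p = m * q := fun m p q hp => by rw [hp]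
  -- A certificate in degree four in `a` and two in `b`: instances `h` of the linearized identity,
  -- some multiplied through by `k`. Modulo commutativity only linear algebra on monomials remains.
  linear_combination (norm := skip)
        (1/2 : ℝ) • (h b b (a * a) (a * a)) + (6 : ℝ) • (h a b (a * b) (a * a)) +
        (-2 : ℝ) • (h a b (a * a) (a * b)) + (4 : ℝ) • (h a (a * a) (a * b) b) +
        (-8 : ℝ) • (h b (a * a) (a * b) a) + (4 : ℝ) • (h a (a * b) (a * b) a) +
        (-8/3 : ℝ) • (h a a a (b * (a * b))) + (-3 : ℝ) • (k b (h a a b (a * a))) +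
        (-1 : ℝ) • (h b (a * a) (a * a) b) + (14/3 : ℝ) • (k b (h a a a (a * b))) +
        (-1 : ℝ) • (k a (h a b b (a * a))) + (-3/2 : ℝ) • (h a a (a * a) (b * b)) +
        (-3/2 : ℝ) • (h a a (b * b) (a * a)) + (3 : ℝ) • (h a (a * a) (b * b) a) +
        (1 : ℝ) • (h a a a (a * (b * b))) + (2 : ℝ) • (h a b b (a * (a * a))) +
        (-2 : ℝ) • (k a (h a a b (a * b))) + (4 : ℝ) • (h a a b (a * (a * b))) +
        (-1/3 : ℝ) • (k (b * b) (h a a a a)) + (-6 : ℝ) • (h a a (a * b) (a * b)) +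
        (-4/3 : ℝ) • (k b (k b (h a a a a))) + (-4 : ℝ) • (h a b (b * (a * a)) a) +
        (4 : ℝ) • (k b (h a b (a * a) a))
  simp only [quadRep, mul_sub, sub_mul, mul_add, smul_mul_assoc, mul_smul_comm]
  simp only [mul_comm]
  module

/-- In triple products, `{b, P(a)b, x} = {P(b)a, a, x}`. It evaluates the mixed term in the
Sherman–Morrison formula. -/
theorem triple_quadRep (a b x : V) :
    b * (x * quadRep a b) + x * (b * quadRep a b) - (b * x) * quadRep a b =
      quadRep b a * (x * a) + x * (quadRep b a * a) - (quadRep b a * x) * a := by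
  have h := fun p q r s : V => jordan_linearized p q r s
  have k : ∀ (m : V) {p q : V}, p = q → m * p = m * q := fun m p q hp => by rw [hp]
  linear_combination (norm := skip)
        (-1/2 : ℝ) • (h b b (a * a) x) + (2 : ℝ) • (h a b (a * b) x) +
        (-1 : ℝ) • (k x (h a a b b)) + (1 : ℝ) • (k x (h a b b a)) +
        (-1/2 : ℝ) • (h a a (b * b) x)
  simp only [quadRep, mul_sub, sub_mul, mul_add, smul_mul_assoc, mul_smul_comm]
  simp only [mul_comm]
  module

end Jordan

/-- A positive definite symmetric bilinear form for which the product is associative. -/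
structure IsAssociativeInner {V : Type*} [NonAssocCommRing V] [Module ℝ V]
    (B : LinearMap.BilinForm ℝ V) : Prop where
  symm : ∀ x y, B x y = B y x
  pos : ∀ x, x ≠ 0 → 0 < B x x
  assoc : ∀ x y z, B x (y * z) = B (x * y) z

/-! ### Idempotents and the Peirce decomposition -/

section Idempotent

variable {V : Type*} [NonAssocCommRing V] [Module ℝ V] {B : LinearMap.BilinForm ℝ V}

namespace IsAssociativeInner

theorem nonneg (hB : IsAssociativeInner B) (x : V) : 0 ≤ B x x := by
  by_cases h : x = 0
  · simp [h]
  · exact (hB.pos x h).le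

theorem eq_zero (hB : IsAssociativeInner B) {x : V} (h : B x x = 0) : x = 0 := by
  by_contra hx
  exact (hB.pos x hx).ne' h

theorem mul_left (hB : IsAssociativeInner B) (x y z : V) : B (x * y) z = B y (x * z) := by
  rw [hB.assoc, mul_comm]

theorem inner_sq_idempotent (hB : IsAssociativeInner B) (a c : V) :
    B (a * a) c = B (c * a) a := by
  rw [hB.mul_left, hB.symm, mul_comm]

end IsAssociativeInner

/-- The Peirce equation `L(2L - 1)(L - 1) = 0` for multiplication `L` by `c`: its eigenvalues are
among `0, 1/2, 1`. -/
theorem mul_mul_mul_of_idempotent [IsCommJordan V] {c : V} (hc : c * c = c) (u : V) :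
    (2 : ℝ) • (c * (c * (c * u))) = (3 : ℝ) • (c * (c * u)) - c * u := by
  have h := mul_mul_mul_eq c c c u
  simp only [hc] at h
  linear_combination (norm := module) h

variable [IsScalarTower ℝ V V] [SMulCommClass ℝ V V]

/-- `2L² - L` projects onto the Peirce space of eigenvalue `1`, and `L - L²` is a quarter of the
projection onto that of `1/2`; hence the weight `8 = (1/2) · 4²`. -/
theorem IsAssociativeInner.inner_idempotent_mul [IsCommJordan V] (hB : IsAssociativeInner B)
    {c : V} (hc : c * c = c) (a : V) :
    B (c * a) a = B ((2 : ℝ) • (c * (c * a)) - c * a) ((2 : ℝ) • (c * (c * a)) - c * a) +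
      8 * B (c * a - c * (c * a)) (c * a - c * (c * a)) := by
  have h1 := congrArg (B a) (mul_mul_mul_of_idempotent hc a)
  have h2 := congrArg (fun z => B a (c * z)) (mul_mul_mul_of_idempotent hc a)
  simp only [mul_sub, mul_smul_comm, map_sub, map_smul, LinearMap.sub_apply, LinearMap.smul_apply,
    smul_eq_mul, hB.mul_left] at h1 h2 ⊢
  linarith

theorem IsAssociativeInner.inner_idempotent_mul_nonneg [IsCommJordan V]
    (hB : IsAssociativeInner B) {c : V} (hc : c * c = c) (a : V) : 0 ≤ B (c * a) a := by
  rw [hB.inner_idempotent_mul hc]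
  have := hB.nonneg ((2 : ℝ) • (c * (c * a)) - c * a)
  have := hB.nonneg (c * a - c * (c * a))
  positivity

theorem IsAssociativeInner.idempotent_mul_eq_zero [IsCommJordan V]
    (hB : IsAssociativeInner B) {c : V} (hc : c * c = c) {a : V} (h : B (c * a) a = 0) :
    c * a = 0 := by
  rw [hB.inner_idempotent_mul hc] at h
  have h1 := hB.nonneg ((2 : ℝ) • (c * (c * a)) - c * a)
  have h2 := hB.nonneg (c * a - c * (c * a))
  have h3 := hB.eq_zero (x := (2 : ℝ) • (c * (c * a)) - c * a) (by linarith)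
  have h4 := hB.eq_zero (x := c * a - c * (c * a)) (by linarith)
  linear_combination (norm := module) h3 + (2 : ℝ) • h4

theorem IsAssociativeInner.inner_sq_idempotent_nonneg [IsCommJordan V]
    (hB : IsAssociativeInner B) {c : V} (hc : c * c = c) (a : V) : 0 ≤ B (a * a) c := by
  rw [hB.inner_sq_idempotent]
  exact hB.inner_idempotent_mul_nonneg hc a

theorem IsAssociativeInner.mul_eq_zero_of_inner [IsCommJordan V]
    (hB : IsAssociativeInner B) {a c : V} (ha : a * a = a) (hc : c * c = c) (h : B a c = 0) :
    c * a = 0 := by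
  apply hB.idempotent_mul_eq_zero hc
  rw [← hB.inner_sq_idempotent, ha, h]

end Idempotent

/-! ### Operator commutation for powers of one element -/

section Power

variable {V : Type*} [NonAssocCommRing V] [Module ℝ V] [SMulCommClass ℝ V V]

theorem mulLeft_mul_mul [IsCommJordan V] (a b c : V) :
    LinearMap.mulLeft ℝ (a * (b * c)) =
      LinearMap.mulLeft ℝ a * LinearMap.mulLeft ℝ (b * c) +
      LinearMap.mulLeft ℝ b * LinearMap.mulLeft ℝ (a * c) +
      LinearMap.mulLeft ℝ c * LinearMap.mulLeft ℝ (a * b) -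
      LinearMap.mulLeft ℝ b * LinearMap.mulLeft ℝ a * LinearMap.mulLeft ℝ c -
      LinearMap.mulLeft ℝ c * LinearMap.mulLeft ℝ a * LinearMap.mulLeft ℝ b :=
  LinearMap.ext fun w => mul_mul_mul_eq a b c w

theorem commute_mulLeft_mul_self [IsCommJordan V] (x : V) :
    Commute (LinearMap.mulLeft ℝ x) (LinearMap.mulLeft ℝ (x * x)) :=
  LinearMap.ext fun w => DFunLike.congr_fun (commute_lmul_lmul_sq x) w

theorem commute_mulLeft_iterate [IsScalarTower ℝ V V] [IsCommJordan V] (x : V) (n : ℕ) :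
    Commute (LinearMap.mulLeft ℝ x)
      (LinearMap.mulLeft ℝ ((LinearMap.mulLeft ℝ x ^ n) (1 : V))) := by
  -- The recursion for multiplication by the next power involves multiplication by `x * x`, so
  -- commutation with both operators is carried through the induction.
  have key : ∀ n, ∀ T ∈ ({LinearMap.mulLeft ℝ x, LinearMap.mulLeft ℝ (x * x)} :
      Set (Module.End ℝ V)), Commute T
        (LinearMap.mulLeft ℝ ((LinearMap.mulLeft ℝ x ^ n) (1 : V))) := by
    intro n
    induction n using Nat.twoStepInduction with
    | zero =>
      intro T _
      have : LinearMap.mulLeft ℝ ((LinearMap.mulLeft ℝ x ^ 0) (1 : V)) = 1 := by ext; simp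
      rw [this]
      exact Commute.one_right T
    | one =>
      rintro T (rfl | rfl)
      · simp
      · simpa using (commute_mulLeft_mul_self x).symm
    | more n h1 h2 =>
      intro T hT
      have hx : Commute T (LinearMap.mulLeft ℝ x) := by
        rcases hT with rfl | rfl
        · exact Commute.refl _
        · exact (commute_mulLeft_mul_self x).symm
      have hx2 : Commute T (LinearMap.mulLeft ℝ (x * x)) := by
        rcases hT with rfl | rfl
        · exact commute_mulLeft_mul_self x
        · exact Commute.refl _
      have h1 := h1 T hT
      have h2 := h2 T hT
      rw [pow_succ', Module.End.mul_apply, LinearMap.mulLeft_apply] at h2 ⊢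
      rw [pow_succ', Module.End.mul_apply, LinearMap.mulLeft_apply, mulLeft_mul_mul]
      exact ((((hx.mul_right h2).add_right (hx.mul_right h2)).add_right
        (h1.mul_right hx2)).sub_right ((hx.mul_right hx).mul_right h1)).sub_right
        ((h1.mul_right hx).mul_right hx)
  exact key n _ (Or.inl rfl)

theorem commute_mulLeft_aeval [IsScalarTower ℝ V V] [IsCommJordan V] (x : V) (p : Polynomial ℝ) :
    Commute (LinearMap.mulLeft ℝ x)
      (LinearMap.mulLeft ℝ (Polynomial.aeval (LinearMap.mulLeft ℝ x) p (1 : V))) := by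
  induction p using Polynomial.induction_on' with
  | add p q hp hq =>
    rw [map_add, LinearMap.add_apply]
    have : ∀ a b : V, LinearMap.mulLeft ℝ (a + b) = LinearMap.mulLeft ℝ a + LinearMap.mulLeft ℝ b :=
      fun a b => LinearMap.ext fun w => add_mul a b w
    rw [this]
    exact hp.add_right hq
  | monomial n r =>
    rw [Polynomial.aeval_monomial, Module.End.mul_apply, Module.algebraMap_end_apply]
    have : ∀ a : V, LinearMap.mulLeft ℝ (r • a) = r • LinearMap.mulLeft ℝ a :=
      fun a => LinearMap.ext fun w => smul_mul_assoc r a w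
    rw [this]
    exact (commute_mulLeft_iterate x n).smul_right r

end Power

/-! ### Existence of spectral decompositions -/

section Spectral

variable {V : Type*} [NonAssocCommRing V] [Module ℝ V] {B : LinearMap.BilinForm ℝ V}

theorem LinearMap.BilinForm.exists_finsupp_eigenvectors {V : Type*} [AddCommGroup V] [Module ℝ V]
    [FiniteDimensional ℝ V] (B : LinearMap.BilinForm ℝ V) (symm : ∀ x y, B x y = B y x)
    (pos : ∀ x, x ≠ 0 → 0 < B x x) (T : Module.End ℝ V) (hT : ∀ x y, B (T x) y = B x (T y))
    (v : V) : ∃ f : ℝ →₀ V, (∀ μ, T (f μ) = μ • f μ) ∧ (f.sum fun _ w => w) = v := by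
  have nonneg : ∀ x, 0 ≤ B x x := fun x => by
    by_cases h : x = 0
    · simp [h]
    · exact (pos x h).le
  let core : InnerProductSpace.Core ℝ V :=
    { inner := fun x y => B x y
      conj_inner_symm := fun x y => by simpa using symm y x
      re_inner_nonneg := fun x => by simpa using nonneg x
      add_left := fun x y z => by simp
      smul_left := fun x y r => by simp
      definite := fun x hx => by
        by_contra h
        exact (pos x h).ne' hx }
  let _ : NormedAddCommGroup V := core.toNormedAddCommGroup
  let _ : InnerProductSpace ℝ V := InnerProductSpace.ofCore core.toCore
  have hs : T.IsSymmetric := fun x y => hT x y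
  have htop : (⨆ μ, Module.End.eigenspace T μ) = ⊤ :=
    Submodule.orthogonal_eq_bot_iff.mp hs.orthogonalComplement_iSup_eigenspaces_eq_bot
  have hv : v ∈ ⨆ μ, Module.End.eigenspace T μ := htop ▸ Submodule.mem_top
  obtain ⟨f, hf, hfv⟩ := (Submodule.mem_iSup_iff_exists_finsupp _ _).mp hv
  exact ⟨f, fun μ => Module.End.mem_eigenspace_iff.mp (hf μ), hfv⟩

/-- A complete system of pairwise orthogonal nonzero idempotents. -/
structure IsOrthogonalSystem {n : ℕ} (q : Fin n → V) : Prop where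
  mul_self : ∀ i, q i * q i = q i
  ne_zero : ∀ i, q i ≠ 0
  orthogonal : ∀ i j, i ≠ j → q i * q j = 0
  complete : ∑ i, q i = 1

variable [IsScalarTower ℝ V V] [SMulCommClass ℝ V V]

theorem IsOrthogonalSystem.card_le [FiniteDimensional ℝ V] {n : ℕ} {q : Fin n → V}
    (hq : IsOrthogonalSystem q) : n ≤ Module.finrank ℝ V := by
  have h : LinearIndependent ℝ q := by
    rw [Fintype.linearIndependent_iff]
    intro g hg i
    have h1 := congrArg (fun z => z * q i) hg
    simp only [Finset.sum_mul, smul_mul_assoc, zero_mul] at h1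
    rw [Finset.sum_eq_single i (fun j _ hj => by rw [hq.orthogonal j i hj, smul_zero])
      (by simp), hq.mul_self] at h1
    exact (smul_eq_zero.mp h1).resolve_right (hq.ne_zero i)
  simpa using h.fintype_card_le_finrank

/-- Split `1` into eigenvectors `f μ` of multiplication by `x`. Each is a Lagrange polynomial in
that operator applied to `1`, so multiplication by it commutes with multiplication by `x`. Thus `f μ
* f ν` is an eigenvector for both `μ` and `ν`, and vanishes if they differ; multiplying `1 = ∑ f ν`
by `f μ` gives idempotency. -/
theorem exists_orthogonalSystem [IsCommJordan V] [FiniteDimensional ℝ V]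
    (hB : IsAssociativeInner B) (x : V) :
    ∃ (n : ℕ) (q : Fin n → V) (l : Fin n → ℝ), IsOrthogonalSystem q ∧ x = ∑ i, l i • q i := by
  obtain ⟨f, hf, h1⟩ := B.exists_finsupp_eigenvectors hB.symm hB.pos (LinearMap.mulLeft ℝ x)
    (fun u v => hB.mul_left x u v) 1
  simp only [LinearMap.mulLeft_apply] at hf
  have hcomm : ∀ μ w, x * (f μ * w) = f μ * (x * w) := by
    intro μ w
    by_cases hμ : μ ∈ f.support
    · have : Polynomial.aeval (LinearMap.mulLeft ℝ x) (Lagrange.basis f.support id μ) (1 : V) =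
          f μ := by
        have hb : ∀ ν ∈ f.support, Polynomial.aeval (LinearMap.mulLeft ℝ x)
            (Lagrange.basis f.support id μ) (f ν) = if ν = μ then f μ else 0 := by
          intro ν hν
          rw [Module.End.aeval_apply_of_mem_apply_eq_smul (μ := ν) (hf ν)]
          split_ifs with h
          · subst h
            have := Lagrange.eval_basis_self (v := id) (Function.injective_id.injOn) hν
            rw [id] at this
            rw [this, one_smul]
          · have := Lagrange.eval_basis_of_ne (v := id) (Ne.symm h) hν
            rw [id] at this
            rw [this, zero_smul]
        rw [← h1, Finsupp.sum, map_sum, Finset.sum_congr rfl hb, Finset.sum_ite_eq', if_pos hμ]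
      have hc := commute_mulLeft_aeval x (Lagrange.basis f.support id μ)
      rw [this] at hc
      exact LinearMap.congr_fun hc w
    · simp [Finsupp.notMem_support_iff.mp hμ]
  have horth : ∀ μ ν, μ ≠ ν → f μ * f ν = 0 := by
    intro μ ν h
    have e1 := hcomm μ (f ν)
    have e2 := hcomm ν (f μ)
    rw [hf, mul_smul_comm] at e1 e2
    rw [mul_comm (f ν), e1] at e2
    have e3 : (ν - μ) • (f μ * f ν) = 0 := by rw [sub_smul, e2, sub_self]
    exact (smul_eq_zero.mp e3).resolve_left (sub_ne_zero.mpr h.symm)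
  have hidem : ∀ μ, f μ * f μ = f μ := by
    intro μ
    have e := congrArg (fun z => f μ * z) h1
    simp only [Finsupp.sum, Finset.mul_sum, mul_one] at e
    rwa [Finset.sum_eq_single μ (fun ν _ h => horth μ ν h.symm) (fun h => by
      rw [Finsupp.notMem_support_iff.mp h, mul_zero])] at e
  let e := f.support.equivFin.symm
  have hsum : ∀ g : ℝ → V, ∑ i, g (e i) = ∑ μ ∈ f.support, g μ := fun g => by
    rw [Equiv.sum_comp e (fun μ : f.support => g μ), Finset.sum_coe_sort]
  refine ⟨f.support.card, fun i => f (e i), fun i => e i, ⟨fun i => hidem _,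
    fun i => Finsupp.mem_support_iff.mp (e i).2, fun i j h => horth _ _ fun h' =>
      h (e.injective (Subtype.ext h')), ?_⟩, ?_⟩
  · rw [hsum f, ← h1, Finsupp.sum]
  · rw [hsum fun μ => μ • f μ]
    simp only [← hf]
    rw [← Finset.mul_sum]
    have : ∑ μ ∈ f.support, f μ = 1 := h1
    rw [this, mul_one]

theorem IsOrthogonalSystem.exists_refinement [IsCommJordan V] (hB : IsAssociativeInner B) {n : ℕ}
    {q : Fin n → V} (hq : IsOrthogonalSystem q) (h : ¬ ∀ i, IsPrimitiveIdempotent (q i))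
    (l : Fin n → ℝ) :
    ∃ (q' : Fin (n + 1) → V) (l' : Fin (n + 1) → ℝ), IsOrthogonalSystem q' ∧
      ∑ i, l' i • q' i = ∑ i, l i • q i := by
  push Not at h
  obtain ⟨i, hi⟩ := h
  have : ∃ a b : V, a * a = a ∧ b * b = b ∧ a + b = q i ∧ a ≠ 0 ∧ b ≠ 0 := by
    by_contra hcon
    push Not at hcon
    refine hi ⟨hq.mul_self i, hq.ne_zero i, fun a b ha hb hab => ?_⟩
    by_cases h0 : a = 0
    · exact Or.inl h0
    · exact Or.inr (hcon a b ha hb hab h0)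
  obtain ⟨a, b, ha, hb, hab, ha0, hb0⟩ := this
  have hab0 : a * b = 0 := by
    have e := hq.mul_self i
    rw [← hab, mul_add, add_mul, add_mul, ha, hb, mul_comm b a] at e
    have : (2 : ℝ) • (a * b) = 0 := by linear_combination (norm := module) e
    exact (smul_eq_zero.mp this).resolve_left two_ne_zero
  -- `B a (q j)` and `B b (q j)` are nonnegative with sum `B (q i) (q j) = 0`, so both vanish.
  have hj : ∀ j, j ≠ i → q j * a = 0 ∧ q j * b = 0 := by
    intro j hji
    have e : B a (q j) + B b (q j) = 0 := by
      rw [← LinearMap.add_apply, ← map_add, hab]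
      have := hB.assoc 1 (q i) (q j)
      rw [hq.orthogonal i j hji.symm, one_mul, map_zero] at this
      exact this.symm
    have ea := hB.inner_sq_idempotent_nonneg (hq.mul_self j) a
    have eb := hB.inner_sq_idempotent_nonneg (hq.mul_self j) b
    rw [ha] at ea
    rw [hb] at eb
    exact ⟨hB.mul_eq_zero_of_inner ha (hq.mul_self j) (by linarith),
      hB.mul_eq_zero_of_inner hb (hq.mul_self j) (by linarith)⟩
  have hsum : ∀ g : Fin n → ℝ, g i • b + ∑ j, g j • Function.update q i a j = ∑ j, g j • q j := by
    intro g
    rw [← Finset.add_sum_erase _ _ (Finset.mem_univ i),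
      ← Finset.add_sum_erase Finset.univ (fun j => g j • q j) (Finset.mem_univ i), ← add_assoc,
      Function.update_self, ← smul_add, add_comm b, hab]
    congr 1
    refine Finset.sum_congr rfl fun j hj => ?_
    rw [Function.update_of_ne (Finset.ne_of_mem_erase hj)]
  refine ⟨Fin.cons b (Function.update q i a), Fin.cons (l i) l, ⟨?_, ?_, ?_, ?_⟩, ?_⟩
  · intro k
    refine Fin.cases hb (fun j => ?_) k
    rw [Fin.cons_succ]
    by_cases h : j = i
    · subst h; simpa using ha
    · simpa [h] using hq.mul_self j
  · intro k
    refine Fin.cases hb0 (fun j => ?_) k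
    rw [Fin.cons_succ]
    by_cases h : j = i
    · subst h; simpa using ha0
    · simpa [h] using hq.ne_zero j
  · have hbj : ∀ j, b * Function.update q i a j = 0 := by
      intro j
      by_cases h : j = i
      · subst h; simpa [mul_comm] using hab0
      · simpa [h, mul_comm] using (hj j h).2
    intro k k'
    refine Fin.cases (Fin.cases (fun h => (h rfl).elim) (fun j _ => ?_) k')
      (fun j => Fin.cases (fun _ => ?_) (fun j' hjj => ?_) k') k
    · simpa using hbj j
    · simpa [mul_comm] using hbj j
    · have hne : j ≠ j' := fun h => hjj (h ▸ rfl)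
      simp only [Fin.cons_succ]
      by_cases h : j = i
      · subst h
        simpa [hne.symm, mul_comm] using (hj j' hne.symm).1
      · by_cases h' : j' = i
        · subst h'
          simpa [h] using (hj j h).1
        · simpa [h, h'] using hq.orthogonal j j' hne
  · have := hsum fun _ => 1
    simp only [one_smul] at this
    rw [Fin.sum_univ_succ]
    simpa [hq.complete] using this
  · rw [Fin.sum_univ_succ]
    simpa using hsum l

theorem IsOrthogonalSystem.nonempty_spectralDecomposition [IsCommJordan V]
    [FiniteDimensional ℝ V] (hB : IsAssociativeInner B) {n : ℕ} {q : Fin n → V}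
    (hq : IsOrthogonalSystem q) (l : Fin n → ℝ) :
    Nonempty (SpectralDecomposition (∑ i, l i • q i)) := by
  by_cases h : ∀ i, IsPrimitiveIdempotent (q i)
  · exact ⟨⟨n, l, q, ⟨h, hq.orthogonal, hq.complete⟩, rfl⟩⟩
  · obtain ⟨q', l', hq', hl⟩ := hq.exists_refinement hB h l
    -- The dimension bound makes the termination measure strictly decrease.
    have := hq'.card_le
    rw [← hl]
    exact hq'.nonempty_spectralDecomposition hB l'
  termination_by Module.finrank ℝ V - n

theorem nonempty_spectralDecomposition [IsCommJordan V] [FiniteDimensional ℝ V]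
    (hB : IsAssociativeInner B) (x : V) : Nonempty (SpectralDecomposition x) := by
  obtain ⟨n, q, l, hq, rfl⟩ := exists_orthogonalSystem hB x
  exact hq.nonempty_spectralDecomposition hB l

end Spectral

/-! ### Functional calculus and tests by idempotents -/

section Functional

variable {V : Type*} [NonAssocCommRing V] [Module ℝ V] {B : LinearMap.BilinForm ℝ V} {x : V}

theorem IsAssociativeInner.inner_one_idempotent_pos (hB : IsAssociativeInner B) {c : V}
    (hc : c * c = c) (h0 : c ≠ 0) : 0 < B 1 c := by
  have := hB.assoc 1 c c
  rw [one_mul, hc] at this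
  rw [this]
  exact hB.pos c h0

namespace SpectralDecomposition

theorem frame_mul_self (d : SpectralDecomposition x) (i : Fin d.n) :
    d.frame i * d.frame i = d.frame i :=
  (d.isJordanFrame.primitive i).mul_self

theorem inner_apply (d : SpectralDecomposition x) (B : LinearMap.BilinForm ℝ V) (f : ℝ → ℝ)
    (c : V) : B (d.apply f) c = ∑ i, f (d.eigenvalue i) * B (d.frame i) c := by
  simp [SpectralDecomposition.apply]

theorem sum_inner_frame (d : SpectralDecomposition x) (B : LinearMap.BilinForm ℝ V) (c : V) :
    ∑ i, B (d.frame i) c = B 1 c := by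
  rw [← d.isJordanFrame.complete, map_sum, LinearMap.sum_apply]

variable [IsScalarTower ℝ V V] [SMulCommClass ℝ V V]

theorem apply_mul_frame (d : SpectralDecomposition x) (f : ℝ → ℝ) (j : Fin d.n) :
    d.apply f * d.frame j = f (d.eigenvalue j) • d.frame j := by
  rw [SpectralDecomposition.apply, Finset.sum_mul, Finset.sum_eq_single j]
  · rw [smul_mul_assoc, d.frame_mul_self]
  · intro i _ hij
    rw [smul_mul_assoc, d.isJordanFrame.orthogonal i j hij, smul_zero]
  · simp

theorem apply_mul_apply (d : SpectralDecomposition x) (f g : ℝ → ℝ) :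
    d.apply f * d.apply g = d.apply (fun t => f t * g t) := by
  conv_lhs => rw [SpectralDecomposition.apply.eq_1 d g]
  rw [Finset.mul_sum]
  refine Finset.sum_congr rfl fun j _ => ?_
  rw [mul_smul_comm, d.apply_mul_frame, smul_smul, mul_comm]

theorem frame_mul_frame_mul [IsCommJordan V] (d : SpectralDecomposition x) (i j : Fin d.n)
    (w : V) : d.frame i * (d.frame j * w) = d.frame j * (d.frame i * w) := by
  by_cases h : i = j
  · rw [h]
  · have := jordan_linearized (d.frame i) (d.frame i) (d.frame j) w
    simpa [d.isJordanFrame.orthogonal i j h, d.isJordanFrame.orthogonal j i (Ne.symm h),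
      d.frame_mul_self] using this.symm

theorem apply_mul_apply_mul [IsCommJordan V] (d : SpectralDecomposition x) (f g : ℝ → ℝ) (w : V) :
    d.apply f * (d.apply g * w) = d.apply g * (d.apply f * w) := by
  simp only [SpectralDecomposition.apply, Finset.sum_mul, Finset.mul_sum, smul_mul_assoc,
    mul_smul_comm, Finset.smul_sum]
  rw [Finset.sum_comm]
  refine Finset.sum_congr rfl fun i _ => Finset.sum_congr rfl fun j _ => ?_
  rw [smul_comm, d.frame_mul_frame_mul]

/-- The spectral decomposition of `x + r • 1` along the frame of `x`. -/
def addSMulOne (d : SpectralDecomposition x) (r : ℝ) : SpectralDecomposition (x + r • (1 : V)) where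
  n := d.n
  eigenvalue i := d.eigenvalue i + r
  frame := d.frame
  isJordanFrame := d.isJordanFrame
  eq_sum := by
    conv_lhs => rw [d.eq_sum, ← d.isJordanFrame.complete]
    simp only [Finset.smul_sum, add_smul, Finset.sum_add_distrib]

end SpectralDecomposition

variable [IsScalarTower ℝ V V] [SMulCommClass ℝ V V]

theorem inner_frame (hB : IsAssociativeInner B) (d : SpectralDecomposition x) (i : Fin d.n) :
    B x (d.frame i) = d.eigenvalue i * B (d.frame i) (d.frame i) := by
  have e := hB.assoc 1 (d.apply id) (d.frame i)
  have hx : x = d.apply id := d.eq_sum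
  rw [one_mul, d.apply_mul_frame, ← hx, map_smul, smul_eq_mul] at e
  have e1 := hB.assoc 1 (d.frame i) (d.frame i)
  rw [one_mul, d.frame_mul_self] at e1
  rw [← e, e1, id]

variable [IsCommJordan V]

theorem IsAssociativeInner.inner_idempotent_nonneg (hB : IsAssociativeInner B) {a c : V}
    (ha : a * a = a) (hc : c * c = c) : 0 ≤ B a c := by
  rw [← ha]
  exact hB.inner_sq_idempotent_nonneg hc a

/-- Testing against the frame of `u` already forces nonnegative eigenvalues, and then `u` has a
square root along that frame. -/
theorem mem_coneOfSquares_iff [FiniteDimensional ℝ V] (hB : IsAssociativeInner B) {u : V} :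
    u ∈ coneOfSquares V ↔ ∀ c : V, c * c = c → 0 ≤ B u c := by
  constructor
  · rintro ⟨a, rfl⟩ c hc
    exact hB.inner_sq_idempotent_nonneg hc a
  · intro h
    obtain ⟨d⟩ := nonempty_spectralDecomposition hB u
    have hd : ∀ i, 0 ≤ d.eigenvalue i := by
      intro i
      have h1 := h _ (d.frame_mul_self i)
      rw [inner_frame hB] at h1
      exact nonneg_of_mul_nonneg_left h1 (hB.pos _ (d.isJordanFrame.primitive i).ne_zero)
    refine ⟨d.apply Real.sqrt, ?_⟩
    rw [d.apply_mul_apply]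
    refine d.eq_sum.trans (Finset.sum_congr rfl fun i _ => ?_)
    beta_reduce
    rw [Real.mul_self_sqrt (hd i)]

theorem coneLE_iff [FiniteDimensional ℝ V] (hB : IsAssociativeInner B) {u v : V} :
    ConeLE u v ↔ ∀ c : V, c * c = c → B u c ≤ B v c := by
  simp only [ConeLE, mem_coneOfSquares_iff hB, map_sub, LinearMap.sub_apply, sub_nonneg]

theorem eigenvalue_pos_iff (hB : IsAssociativeInner B)
    (d : SpectralDecomposition x) :
    (∀ i, 0 < d.eigenvalue i) ↔ ∀ c : V, c * c = c → c ≠ 0 → 0 < B x c := by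
  constructor
  · intro h c hc h0
    have hx : B x c = ∑ i, d.eigenvalue i * B (d.frame i) c := by
      conv_lhs => rw [d.eq_sum]
      exact d.inner_apply B id c
    have hn := fun i => hB.inner_idempotent_nonneg (d.frame_mul_self i) hc
    obtain ⟨i, -, hi⟩ : ∃ i ∈ Finset.univ, 0 < B (d.frame i) c := by
      apply Finset.exists_lt_of_sum_lt (f := fun _ => (0 : ℝ))
      rw [Finset.sum_const_zero, d.sum_inner_frame]
      exact hB.inner_one_idempotent_pos hc h0
    rw [hx]
    exact Finset.sum_pos' (fun j _ => mul_nonneg (h j).le (hn j))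
      ⟨i, Finset.mem_univ i, mul_pos (h i) hi⟩
  · intro h i
    have h1 := h _ (d.frame_mul_self i) (d.isJordanFrame.primitive i).ne_zero
    rw [inner_frame hB] at h1
    exact pos_of_mul_pos_left h1 (hB.nonneg _)

theorem eigenvaluesIn_Ioi_iff [FiniteDimensional ℝ V] (hB : IsAssociativeInner B) :
    EigenvaluesIn (Set.Ioi 0) x ↔ ∀ c : V, c * c = c → c ≠ 0 → 0 < B x c := by
  constructor
  · rintro ⟨d, hd⟩
    exact (eigenvalue_pos_iff hB d).mp hd
  · intro h
    obtain ⟨d⟩ := nonempty_spectralDecomposition hB x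
    exact ⟨d, (eigenvalue_pos_iff hB d).mpr h⟩

theorem EigenvaluesIn.add_mem_coneOfSquares [FiniteDimensional ℝ V] (hB : IsAssociativeInner B)
    (hx : EigenvaluesIn (Set.Ioi 0) x) {k : V} (hk : k ∈ coneOfSquares V) :
    EigenvaluesIn (Set.Ioi 0) (x + k) := by
  rw [eigenvaluesIn_Ioi_iff hB] at hx ⊢
  rw [mem_coneOfSquares_iff hB] at hk
  intro c hc h0
  rw [map_add, LinearMap.add_apply]
  exact add_pos_of_pos_of_nonneg (hx c hc h0) (hk c hc)

/-! ### Quadratic representation and primitive idempotents -/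

section Primitive

/-- Since `B (u * u) (1 - c) = 0`, every frame element of `u` with nonzero eigenvalue is orthogonal
to `1 - c`. It is then a subidempotent of `c`, hence equal to `c` by primitivity. -/
theorem IsPrimitiveIdempotent.eq_smul_of_mul_eq [FiniteDimensional ℝ V]
    (hB : IsAssociativeInner B) {c u : V} (hc : IsPrimitiveIdempotent c) (hu : c * u = u) :
    ∃ r : ℝ, u = r • c := by
  obtain ⟨d⟩ := nonempty_spectralDecomposition hB u
  have hc1 : (1 - c) * (1 - c) = 1 - c := by
    simp [sub_mul, mul_sub, hc.mul_self]
  have hsum : ∑ i, d.eigenvalue i ^ 2 * B (d.frame i) (1 - c) = 0 := by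
    have hu' : u = d.apply id := d.eq_sum
    have h1 : B (u * u) (1 - c) = 0 := by
      rw [hB.inner_sq_idempotent, sub_mul, one_mul, hu, sub_self, map_zero, LinearMap.zero_apply]
    rw [hu', d.apply_mul_apply, d.inner_apply] at h1
    simpa [sq] using h1
  have hn := fun i => hB.inner_idempotent_nonneg (d.frame_mul_self i) hc1
  have hq : ∀ i, d.eigenvalue i ≠ 0 → d.frame i = c := by
    intro i hi
    have h0 := (Finset.sum_eq_zero_iff_of_nonneg fun i _ =>
      mul_nonneg (sq_nonneg (d.eigenvalue i)) (hn i)).mp hsum i (Finset.mem_univ i)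
    have h1 := (mul_eq_zero.mp h0).resolve_left (pow_ne_zero 2 hi)
    have h2 := hB.mul_eq_zero_of_inner (d.frame_mul_self i) hc1 h1
    rw [sub_mul, one_mul, sub_eq_zero] at h2
    have h3 : (c - d.frame i) * (c - d.frame i) = c - d.frame i := by
      rw [sub_mul, mul_sub, mul_sub, mul_comm (d.frame i) c, ← h2, d.frame_mul_self, hc.mul_self,
        sub_self, sub_zero]
    rcases hc.primitive _ _ (d.frame_mul_self i) h3 (by abel) with h | h
    · exact ((d.isJordanFrame.primitive i).ne_zero h).elim
    · exact (sub_eq_zero.mp h).symm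
  refine ⟨∑ i, d.eigenvalue i, ?_⟩
  rw [Finset.sum_smul]
  refine d.eq_sum.trans (Finset.sum_congr rfl fun i _ => ?_)
  by_cases hi : d.eigenvalue i = 0
  · rw [hi, zero_smul, zero_smul]
  · rw [hq i hi]

theorem IsPrimitiveIdempotent.quadRep_eq [FiniteDimensional ℝ V]
    (hB : IsAssociativeInner B) {c : V} (hc : IsPrimitiveIdempotent c) (u : V) :
    quadRep c u = (B u c / B c c) • c := by
  obtain ⟨r, hr⟩ := hc.eq_smul_of_mul_eq hB (u := quadRep c u) (by
    have := mul_mul_mul_of_idempotent hc.mul_self u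
    simp only [quadRep, hc.mul_self, mul_sub, mul_smul_comm]
    linear_combination (norm := module) this)
  have h1 : B (quadRep c u) c = B u c := by
    simp only [quadRep, hc.mul_self, map_sub, map_smul, LinearMap.sub_apply, LinearMap.smul_apply,
      hB.mul_left, smul_eq_mul]
    ring
  have h2 : 0 < B c c := hB.pos c hc.ne_zero
  rw [hr] at h1 ⊢
  rw [← h1, map_smul, LinearMap.smul_apply, smul_eq_mul, mul_div_cancel_right₀ _ h2.ne']

/-- `(P(z)c)² = k P(z)c` with `k = B (z * z) c / B c c ≥ 0`. If `k > 0`, rescaling by `k^(-1/2)`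
gives a square root; if `k = 0`, the square vanishes and so does `P(z)c`. -/
theorem IsPrimitiveIdempotent.quadRep_mem_coneOfSquares [FiniteDimensional ℝ V]
    (hB : IsAssociativeInner B) {c : V} (hc : IsPrimitiveIdempotent c) (z : V) :
    quadRep z c ∈ coneOfSquares V := by
  have h : quadRep z c * quadRep z c = (B (z * z) c / B c c) • quadRep z c := by
    rw [quadRep_mul_self, hc.quadRep_eq hB]
    simp only [quadRep, mul_smul_comm, smul_sub]
    rw [smul_comm]
  rcases (div_nonneg (hB.inner_sq_idempotent_nonneg hc.mul_self z)
    (hB.nonneg c)).eq_or_lt with h0 | hpos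
  · rw [← h0, zero_smul] at h
    have : B (quadRep z c) (quadRep z c) = 0 := by
      have := hB.assoc 1 (quadRep z c) (quadRep z c)
      rwa [h, map_zero, one_mul, eq_comm] at this
    exact ⟨0, by rw [hB.eq_zero this, mul_zero]⟩
  · refine ⟨(Real.sqrt (B (z * z) c / B c c))⁻¹ • quadRep z c, ?_⟩
    rw [smul_mul_assoc, mul_smul_comm, h, smul_smul, smul_smul, ← mul_inv,
      Real.mul_self_sqrt hpos.le, inv_mul_cancel₀ hpos.ne', one_smul]

end Primitive

end Functional

/-! ### Inverses and their antitonicity -/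

section Inverse

variable {V : Type*} [NonAssocCommRing V]

/-- `z` is the inverse of `x`: `x z = 1`, `x² z = x`, `z² x = z`, and multiplication by `x` commutes
with multiplication by `z` and `z²`, and vice versa. -/
structure IsJordanInverse (x z : V) : Prop where
  mul : x * z = 1
  sq_mul : (x * x) * z = x
  mul_sq : (z * z) * x = z
  comm : ∀ w, x * (z * w) = z * (x * w)
  comm_sq : ∀ w, x * ((z * z) * w) = (z * z) * (x * w)
  sq_comm : ∀ w, z * ((x * x) * w) = (x * x) * (z * w)

theorem IsJordanInverse.symm {x z : V} (h : IsJordanInverse x z) : IsJordanInverse z x where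
  mul := by rw [mul_comm, h.mul]
  sq_mul := h.mul_sq
  mul_sq := h.sq_mul
  comm w := (h.comm w).symm
  comm_sq := h.sq_comm
  sq_comm := h.comm_sq

variable [Module ℝ V]

theorem IsJordanInverse.quadRep_self {x z : V} (h : IsJordanInverse x z) : quadRep x z = x := by
  rw [quadRep, h.mul, mul_one, h.sq_mul, two_smul, add_sub_cancel_right]

variable [IsCommJordan V]

theorem IsJordanInverse.mul_quadRep [SMulCommClass ℝ V V] {x z : V} (h : IsJordanInverse x z)
    (w : V) : z * quadRep x w = x * w := by
  have e := mul_mul_mul_eq x x z w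
  rw [h.mul, mul_one, one_mul, ← h.comm (x * w), ← h.comm w] at e
  rw [quadRep, mul_sub, mul_smul_comm, ← h.comm (x * w), ← h.comm w]
  linear_combination (norm := module) e

variable [IsScalarTower ℝ V V] [SMulCommClass ℝ V V]

theorem IsJordanInverse.quadRep_quadRep {x z : V} (h : IsJordanInverse x z) (w : V) :
    quadRep z (quadRep x w) = w := by
  have e := mul_mul_mul_eq x (z * z) x w
  rw [h.mul_sq, mul_comm x (z * z), h.mul_sq, h.mul, one_mul, h.comm_sq, h.comm_sq, h.comm] at e
  have e2 : (z * z) * quadRep x w = (2 : ℝ) • ((z * z) * (x * (x * w))) - (z * z) * ((x * x) * w) :=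
    by rw [quadRep, mul_sub, mul_smul_comm]
  rw [quadRep.eq_1 z, h.mul_quadRep, e2]
  linear_combination (norm := module) -e

/-- A candidate inverse of an invertible `x` thus needs only the single check `P(x)w = x`. -/
theorem IsJordanInverse.eq_of_quadRep_eq {x z w : V} (h : IsJordanInverse x z)
    (hw : quadRep x w = x) : w = z := by
  rw [← h.quadRep_quadRep w, hw, h.symm.quadRep_self]

theorem SpectralDecomposition.isJordanInverse {x : V} (d : SpectralDecomposition x)
    (hd : ∀ i, d.eigenvalue i ≠ 0) : IsJordanInverse x (d.apply fun t => t⁻¹) := by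
  have hx : x = d.apply id := d.eq_sum
  have hc : ∀ f g : ℝ → ℝ, (∀ i, f (d.eigenvalue i) = g (d.eigenvalue i)) → d.apply f = d.apply g :=
    fun f g h => Finset.sum_congr rfl fun i _ => by rw [h]
  have key : IsJordanInverse (d.apply id) (d.apply fun t => t⁻¹) := by
    constructor
    · rw [d.apply_mul_apply, hc _ (fun _ => 1) fun i => mul_inv_cancel₀ (hd i)]
      simp [SpectralDecomposition.apply, d.isJordanFrame.complete]
    · rw [d.apply_mul_apply, d.apply_mul_apply]
      exact hc _ _ fun i => by have := hd i; simp only [id]; field_simp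
    · rw [d.apply_mul_apply, d.apply_mul_apply]
      exact hc _ _ fun i => by have := hd i; simp only [id]; field_simp
    · exact d.apply_mul_apply_mul _ _
    · rw [d.apply_mul_apply]
      exact d.apply_mul_apply_mul _ _
    · rw [d.apply_mul_apply]
      exact d.apply_mul_apply_mul _ _
  rwa [← hx] at key

theorem EigenvaluesIn.isJordanInverse {x : V} (hx : EigenvaluesIn (Set.Ioi 0) x) :
    IsJordanInverse x (jordanInv x) := by
  obtain ⟨d, hd⟩ := hx
  rw [jordanInv, jordanFun_eq d]
  exact d.isJordanInverse fun i => (hd i).ne'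

theorem quadRep_add_smul (x c u : V) (r : ℝ) :
    quadRep (x + r • c) u = quadRep x u +
      (2 * r) • (c * (x * u) + x * (c * u) - (c * x) * u) + (r ^ 2) • quadRep c u := by
  simp only [quadRep, mul_add, add_mul, smul_mul_assoc, mul_smul_comm, mul_comm x c]
  module

variable [FiniteDimensional ℝ V] {B : LinearMap.BilinForm ℝ V}

/-- The Sherman–Morrison formula for the inverse of `x + r • c`. -/
theorem IsJordanInverse.quadRep_add_smul_primitive (hB : IsAssociativeInner B) {x z c : V}
    (h : IsJordanInverse x z) (hc : IsPrimitiveIdempotent c) {r m : ℝ} (hm : m = B z c / B c c)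
    (hr : 1 + r * m ≠ 0) :
    quadRep (x + r • c) (z - (r / (1 + r * m)) • quadRep z c) = x + r • c := by
  have hsub : ∀ (a : V) (k : ℝ) (u v : V), quadRep a (u - k • v) = quadRep a u - k • quadRep a v := by
    intro a k u v
    simp only [quadRep, mul_sub, mul_smul_comm]
    module
  have hcz : quadRep c z = m • c := by rw [hc.quadRep_eq hB, hm]
  have t1 : c * (x * z) + x * (c * z) - (c * x) * z = c := by
    rw [h.mul, mul_one, mul_comm c z, h.comm, mul_comm c x, mul_comm (x * c) z, add_sub_cancel_right]
  -- `{c, P(z)c, x} = {P(c)z, z, x} = m {c, z, x} = m c`.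
  have t2 : c * (x * quadRep z c) + x * (c * quadRep z c) - (c * x) * quadRep z c = m • c := by
    rw [triple_quadRep, hcz, h.mul, mul_one, smul_mul_assoc, smul_mul_assoc, mul_smul_comm,
      smul_mul_assoc, mul_comm c z, h.comm, mul_comm c x, mul_comm (x * c) z, add_sub_cancel_right]
  have t3 : quadRep c (quadRep z c) = m ^ 2 • c := by
    have e := quadRep_mul_self c z
    rw [hc.mul_self, hcz, smul_mul_assoc, mul_smul_comm, hc.mul_self, smul_smul] at e
    rw [← e, sq]
  rw [hsub, quadRep_add_smul, quadRep_add_smul, h.quadRep_self, h.symm.quadRep_quadRep, t1, t2, t3,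
    hcz]
  -- The coefficient of `c` is `2r + r²m - r/(1 + rm) · (1 + rm)² = r`.
  match_scalars
  · ring
  · field_simp
    ring

theorem jordanInv_add_smul_primitive_le (hB : IsAssociativeInner B) {x c : V}
    (hx : EigenvaluesIn (Set.Ioi 0) x) (hc : IsPrimitiveIdempotent c) {r : ℝ} (hr : 0 ≤ r) :
    EigenvaluesIn (Set.Ioi 0) (x + r • c) ∧ ConeLE (jordanInv (x + r • c)) (jordanInv x) := by
  have hcK : r • c ∈ coneOfSquares V :=
    ⟨Real.sqrt r • c, by
      rw [smul_mul_assoc, mul_smul_comm, smul_smul, Real.mul_self_sqrt hr, hc.mul_self]⟩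
  have hpos := hx.add_mem_coneOfSquares hB hcK
  refine ⟨hpos, ?_⟩
  have hz : 0 ≤ B (jordanInv x) c := by
    obtain ⟨d, hd⟩ := hx
    rw [jordanInv, jordanFun_eq d, d.inner_apply]
    exact Finset.sum_nonneg fun i _ => mul_nonneg (inv_nonneg.mpr (hd i).le)
      (hB.inner_idempotent_nonneg (d.frame_mul_self i) hc.mul_self)
  have hm : 0 ≤ B (jordanInv x) c / B c c := div_nonneg hz (hB.nonneg c)
  have hpos' : 0 < 1 + r * (B (jordanInv x) c / B c c) := by positivity
  have e := hpos.isJordanInverse.eq_of_quadRep_eq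
    (hx.isJordanInverse.quadRep_add_smul_primitive hB hc rfl hpos'.ne')
  rw [coneLE_iff hB]
  intro a ha
  have hK := (mem_coneOfSquares_iff hB).mp (hc.quadRep_mem_coneOfSquares hB (jordanInv x)) a ha
  rw [← e, map_sub, map_smul, LinearMap.sub_apply, LinearMap.smul_apply, smul_eq_mul,
    sub_le_self_iff]
  positivity

theorem jordanInv_antitone (hB : IsAssociativeInner B) {x y : V}
    (hx : EigenvaluesIn (Set.Ioi 0) x) (hxy : ConeLE x y) :
    EigenvaluesIn (Set.Ioi 0) y ∧ ConeLE (jordanInv y) (jordanInv x) := by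
  obtain ⟨d⟩ := nonempty_spectralDecomposition hB (y - x)
  have hd : ∀ i, 0 ≤ d.eigenvalue i := by
    intro i
    have h1 := (mem_coneOfSquares_iff hB).mp hxy _ (d.frame_mul_self i)
    rw [inner_frame hB] at h1
    exact nonneg_of_mul_nonneg_left h1 (hB.pos _ (d.isJordanFrame.primitive i).ne_zero)
  have key : ∀ s : Finset (Fin d.n),
      EigenvaluesIn (Set.Ioi 0) (x + ∑ i ∈ s, d.eigenvalue i • d.frame i) ∧
      ConeLE (jordanInv (x + ∑ i ∈ s, d.eigenvalue i • d.frame i)) (jordanInv x) := by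
    intro s
    induction s using Finset.induction_on with
    | empty =>
      rw [Finset.sum_empty, add_zero]
      exact ⟨hx, 0, by rw [sub_self, mul_zero]⟩
    | insert i s hi ih =>
      have h := jordanInv_add_smul_primitive_le hB ih.1 (d.isJordanFrame.primitive i) (hd i)
      rw [Finset.sum_insert hi, add_comm (d.eigenvalue i • d.frame i), ← add_assoc]
      refine ⟨h.1, ?_⟩
      rw [coneLE_iff hB]
      exact fun c hc => ((coneLE_iff hB).mp h.2 c hc).trans ((coneLE_iff hB).mp ih.2 c hc)
  have h := key Finset.univ
  rwa [← d.eq_sum, add_sub_cancel] at h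

end Inverse

/-! ### Monotonicity of the logarithm -/

section Log

variable {V : Type*} [NonAssocCommRing V] [Module ℝ V] [IsScalarTower ℝ V V]
  [SMulCommClass ℝ V V] [IsCommJordan V] [FiniteDimensional ℝ V] {B : LinearMap.BilinForm ℝ V}

theorem hasDerivAt_sum_log_add {n : ℕ} (l b : Fin n → ℝ) (hl : ∀ i, 0 < l i) {r : ℝ}
    (hr : 0 ≤ r) : HasDerivAt (fun r => ∑ i, Real.log (l i + r) * b i) (∑ i, (l i + r)⁻¹ * b i) r := by
  refine HasDerivAt.fun_sum fun i _ => HasDerivAt.mul_const ?_ (b i)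
  simpa using ((hasDerivAt_id r).const_add (l i)).log (by have := hl i; positivity)

/-- For `b i = B (q i) c` the sum `∑ b i = B 1 c` does not depend on the frame, so the divergent
`log r` terms of `x` and `y` cancel. -/
theorem tendsto_sum_log_add_sub {n : ℕ} (l b : Fin n → ℝ) :
    Tendsto (fun r => ∑ i, Real.log (l i + r) * b i - Real.log r * ∑ i, b i) atTop (𝓝 0) := by
  have h : Tendsto (fun r => ∑ i, (Real.log (r + l i) - Real.log r) * b i) atTop
      (𝓝 (∑ i, 0 * b i)) :=
    tendsto_finsetSum _ fun i _ => (Real.tendsto_log_comp_add_sub_log (l i)).mul_const (b i)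
  simp only [zero_mul, Finset.sum_const_zero] at h
  refine h.congr fun r => ?_
  rw [Finset.mul_sum, ← Finset.sum_sub_distrib]
  exact Finset.sum_congr rfl fun i _ => by rw [sub_mul, add_comm]

theorem jordanLog_monotone (hB : IsAssociativeInner B) {x y : V}
    (hx : EigenvaluesIn (Set.Ioi 0) x) (hxy : ConeLE x y) : ConeLE (jordanLog x) (jordanLog y) := by
  obtain ⟨dy, hdy⟩ := (jordanInv_antitone hB hx hxy).1
  have hx' := hx
  obtain ⟨dx, hdx⟩ := hx
  rw [coneLE_iff hB]
  intro c hc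
  set G : ℝ → ℝ := fun r => ∑ i, Real.log (dy.eigenvalue i + r) * B (dy.frame i) c -
    ∑ i, Real.log (dx.eigenvalue i + r) * B (dx.frame i) c with hG
  have hderiv : ∀ r, 0 ≤ r → HasDerivAt G (∑ i, (dy.eigenvalue i + r)⁻¹ * B (dy.frame i) c -
      ∑ i, (dx.eigenvalue i + r)⁻¹ * B (dx.frame i) c) r := fun r hr =>
    (hasDerivAt_sum_log_add _ _ hdy hr).sub (hasDerivAt_sum_log_add _ _ hdx hr)
  have hanti : AntitoneOn G (Set.Ici 0) := by
    refine antitoneOn_of_deriv_nonpos (convex_Ici 0)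
      (fun r hr => (hderiv r hr).continuousAt.continuousWithinAt)
      (fun r hr => (hderiv r (interior_subset hr)).differentiableAt.differentiableWithinAt)
      fun r hr => ?_
    have hr0 : 0 ≤ r := interior_subset hr
    rw [(hderiv r hr0).deriv, sub_nonpos]
    have hxr : EigenvaluesIn (Set.Ioi 0) (x + r • (1 : V)) :=
      ⟨dx.addSMulOne r, fun i => add_pos_of_pos_of_nonneg (hdx i) hr0⟩
    have hle : ConeLE (x + r • (1 : V)) (y + r • (1 : V)) := by
      rwa [ConeLE, add_sub_add_right_eq_sub]
    have h := (coneLE_iff hB).mp (jordanInv_antitone hB hxr hle).2 c hc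
    rw [jordanInv, jordanInv, jordanFun_eq (dx.addSMulOne r), jordanFun_eq (dy.addSMulOne r),
      SpectralDecomposition.inner_apply, SpectralDecomposition.inner_apply] at h
    exact h
  have hlim : Tendsto G atTop (𝓝 0) := by
    have h := (tendsto_sum_log_add_sub dy.eigenvalue fun i => B (dy.frame i) c).sub
      (tendsto_sum_log_add_sub dx.eigenvalue fun i => B (dx.frame i) c)
    rw [sub_zero] at h
    refine h.congr fun r => ?_
    rw [dx.sum_inner_frame, dy.sum_inner_frame, sub_sub_sub_cancel_right]
  have h0 : 0 ≤ G 0 := le_of_tendsto hlim (by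
    filter_upwards [eventually_ge_atTop 0] with r hr
    exact hanti Set.self_mem_Ici hr hr)
  rw [jordanLog, jordanLog, jordanFun_eq dx, jordanFun_eq dy, dx.inner_apply, dy.inner_apply]
  simpa [hG] using h0

end Log

/-! ### Interior of the cone -/

section Topology

variable {V : Type*} [NonAssocCommRing V] [Module ℝ V] [IsScalarTower ℝ V V]
  [SMulCommClass ℝ V V] [IsCommJordan V] [FiniteDimensional ℝ V] [TopologicalSpace V]
  [IsTopologicalAddGroup V] {B : LinearMap.BilinForm ℝ V}

theorem eigenvaluesIn_of_mem_interior [ContinuousSMul ℝ V] (hB : IsAssociativeInner B) {x : V}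
    (hx : x ∈ interior (coneOfSquares V)) : EigenvaluesIn (Set.Ioi 0) x := by
  rw [eigenvaluesIn_Ioi_iff hB]
  intro c hc h0
  -- For some `r > 0`, `x - r • c` is still in the cone, whence `B x c ≥ r * B c c > 0`.
  have hcont : Tendsto (fun r : ℝ => x - r • c) (𝓝[>] 0) (𝓝 x) := by
    have : Continuous fun r : ℝ => x - r • c := by fun_prop
    simpa using this.tendsto 0 |>.mono_left nhdsWithin_le_nhds
  have hev := hcont.eventually (mem_interior_iff_mem_nhds.mp hx)
  obtain ⟨r, hr, hrpos⟩ := (hev.and self_mem_nhdsWithin).exists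
  have h := (mem_coneOfSquares_iff hB).mp hr c hc
  rw [map_sub, map_smul, LinearMap.sub_apply, LinearMap.smul_apply, smul_eq_mul, sub_nonneg] at h
  exact (mul_pos hrpos (hB.pos c h0)).trans_le h

/-- The translate of the interior by `k` is open and stays in the cone, which is closed under
addition. -/
theorem add_mem_interior_coneOfSquares (hB : IsAssociativeInner B) {x k : V}
    (hx : x ∈ interior (coneOfSquares V)) (hk : k ∈ coneOfSquares V) :
    x + k ∈ interior (coneOfSquares V) := by
  refine interior_maximal (t := (· + k) '' interior (coneOfSquares V)) ?_
    (isOpenMap_add_right k _ isOpen_interior) ⟨x, hx, rfl⟩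
  rintro _ ⟨u, hu, rfl⟩
  have hu' := interior_subset hu
  rw [mem_coneOfSquares_iff hB] at hu' hk ⊢
  intro c hc
  rw [map_add, LinearMap.add_apply]
  exact add_nonneg (hu' c hc) (hk c hc)

end Topology

theorem mainTheorem9 {V : Type*} [NonAssocCommRing V] [Module ℝ V]
    [IsScalarTower ℝ V V] [SMulCommClass ℝ V V] [FiniteDimensional ℝ V]
    [TopologicalSpace V] [IsTopologicalAddGroup V] [ContinuousSMul ℝ V] [T2Space V]
    (hV : IsEuclideanJordan V) (x y : V) (hx : ConeLT 0 x) (hxy : ConeLE x y) :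
    ConeLT 0 y ∧
    (EigenvaluesIn (Set.Ioi 0) x ∧ EigenvaluesIn (Set.Ioi 0) y) ∧
    ConeLE (jordanInv y) (jordanInv x) ∧
    ConeLE (jordanLog x) (jordanLog y) := by
  obtain ⟨_, B, hsymm, hpos, hassoc⟩ := hV
  have hB : IsAssociativeInner B := ⟨hsymm, hpos, hassoc⟩
  have hx' : x ∈ interior (coneOfSquares V) := by rwa [ConeLT, sub_zero] at hx
  have hxpos := eigenvaluesIn_of_mem_interior hB hx'
  have hinv := jordanInv_antitone hB hxpos hxy
  refine ⟨?_, ⟨hxpos, hinv.1⟩, hinv.2, jordanLog_monotone hB hxpos hxy⟩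
  have := add_mem_interior_coneOfSquares hB hx' hxy
  rwa [add_sub_cancel, ← sub_zero y] at this
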